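/- Let $\Sigma$ be a finite alphabet. For words $u,v\in\Sigma^*$ write $u\sqsubseteq v$ if $u$ is a (scattered) subword of $v$, i.e. $u$ arises from $v$ by deleting some (possibly no) letters; write $|w|$ for the length of a word $w$ and $|w|_a$ for the number of occurrences of the letter $a$ in $w$. A language $L\subseteq\Sigma^*$ is called bounded if there are $n\in\mathbb{N}$ and words $w_1,\dots,w_n\in\Sigma^*$ with $L\subseteq w_1^*w_2^*\cdots w_n^*$, and unbounded otherwise. Theorem. Let $L\subseteq\Sigma^*$ be an unbounded regular language for which there is a real number $\varepsilon>0$ such that, for every letter $a\in\Sigma$, all but finitely many words $w\in L$ satisfy $|w|_a/|w|>\varepsilon$. Then the $\Sigma_1$-theory of the structure $(L,\sqsubseteq,(w)_{w\in L})$ is decidable. Here the structure has universe $L$, the binary relation $\sqsubseteq$ restricted to $L$, and every word $w\in L$ as a constant; its $\Sigma_1$-theory is the set of all first-order sentences (with equality) of the form $\exists x_1\,\exists x_2\cdots\exists x_n\,\psi$ with $\psi$ quantifier-free that are true in the structure; and decidable means that there is an algorithm which determines whether a given input is (the code of) a sentence in this set. -/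

import Mathlib

/-! ### Properties of formal languages -/

/-- `L` is bounded if `L ⊆ w₁* w₂* ⋯ wₙ*` for finitely many words `w₁, …, wₙ`. -/
def IsBoundedLanguage {A : Type*} (L : Language A) : Prop :=
  ∃ ws : List (List A), L ≤ (ws.map fun w => KStar.kstar ({w} : Language A)).prod

/-- Almost all words from `L` have a non-negligible number of occurrences of every letter:
there is a real `ε > 0` such that for every letter `a`, all but finitely many `w ∈ L` satisfy
`|w|_a / |w| > ε`. (The empty word, whose quotient has no meaning, is a single word and hence
irrelevant.) -/
def HasNonNegligibleLetters {A : Type*} [DecidableEq A] (L : Language A) : Prop :=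
  ∃ ε : ℝ, 0 < ε ∧ ∀ a : A,
    {w : List A | w ∈ L ∧ ¬ (ε < (w.count a : ℝ) / (w.length : ℝ))}.Finite

/-! ### The structure `(L, ⊑, (w)_{w ∈ L})` -/

/-- Function symbols: one constant symbol for each word of `L`, and nothing else. -/
inductive SubwordFunction {A : Type*} (L : Language A) : ℕ → Type _
  | const (w : {w : List A // w ∈ L}) : SubwordFunction L 0

/-- Relation symbols: one binary symbol for the subword relation, and nothing else. -/
inductive SubwordRelation : ℕ → Type
  | sub : SubwordRelation 2

/-- The first-order signature of `(L, ⊑, (w)_{w ∈ L})`. -/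
def subwordSignature {A : Type*} (L : Language A) : FirstOrder.Language where
  Functions := SubwordFunction L
  Relations := SubwordRelation

/-- The structure `(L, ⊑, (w)_{w ∈ L})`: its universe is the set of words of `L`, every constant
is interpreted by itself and the binary relation by the (scattered) subword relation. -/
instance subwordStructure {A : Type*} (L : Language A) :
    (subwordSignature L).Structure {w : List A // w ∈ L} where
  funMap := fun f _ => match f with
    | SubwordFunction.const w => w
  RelMap := fun R => match R with
    | SubwordRelation.sub => fun xs => (xs 0).1.Sublist (xs 1).1

/-- The `Σ₁`-theory of a structure `M`: all sentences `∃ x₁ ⋯ ∃ xₙ, ψ` with `ψ` quantifier-free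
that hold in `M`. -/
def sigmaOneTheory (S : FirstOrder.Language) (M : Type*) [S.Structure M] : Set S.Sentence :=
  {φ | FirstOrder.Language.BoundedFormula.IsExistential φ ∧
    FirstOrder.Language.Sentence.Realize M φ}

/-! ### Gödel numbers and decidability -/

/-- The Gödel number of a term, i.e. of a variable or of a constant. -/
def termCode {A : Type*} [Encodable A] {L : Language A} {n : ℕ} :
    (subwordSignature L).Term (Empty ⊕ Fin n) → ℕ
  | .var (Sum.inr i) => 2 * (i : ℕ)
  | .func (SubwordFunction.const w) _ => 2 * Encodable.encode w.1 + 1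

/-- The Gödel number of a formula. -/
def formulaCode {A : Type*} [Encodable A] {L : Language A} :
    {n : ℕ} → (subwordSignature L).BoundedFormula Empty n → ℕ
  | _, .falsum => 0
  | _, .equal s t => 4 * Nat.pair (termCode s) (termCode t) + 1
  | _, .rel SubwordRelation.sub ts => 4 * Nat.pair (termCode (ts 0)) (termCode (ts 1)) + 2
  | _, .imp φ ψ => 4 * Nat.pair (formulaCode φ) (formulaCode ψ) + 3
  | _, .all φ => 4 * formulaCode φ + 4

/-- Different terms have different Gödel numbers. -/
theorem termCode_injective {A : Type*} [Encodable A] {L : Language A} {n : ℕ} :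
    Function.Injective (termCode (A := A) (L := L) (n := n)) := by
  intro s t h
  rcases s with (e | i) | ⟨⟨w⟩, ss⟩
  · exact e.elim
  · rcases t with (e | j) | ⟨⟨v⟩, ts⟩
    · exact e.elim
    · simp only [termCode] at h
      have : i = j := Fin.ext (by omega)
      rw [this]
    · simp only [termCode] at h
      omega
  · rcases t with (e | j) | ⟨⟨v⟩, ts⟩
    · exact e.elim
    · simp only [termCode] at h
      omega
    · simp only [termCode] at h
      have : w = v := Subtype.ext (Encodable.encode_injective (by omega))
      subst this
      congr 1
      exact funext fun k => k.elim0

/-- Different formulas have different Gödel numbers. -/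
theorem formulaCode_injective {A : Type*} [Encodable A] {L : Language A} {n : ℕ} :
    Function.Injective (formulaCode (A := A) (L := L) (n := n)) := by
  intro φ
  induction φ with
  | falsum => intro ψ h; rcases ψ with _ | _ | ⟨⟨⟩, ts⟩ | _ | _ <;> simp [formulaCode] at h ⊢
  | equal s t =>
    intro ψ h
    rcases ψ with _ | ⟨s', t'⟩ | ⟨⟨⟩, ts⟩ | _ | _ <;> simp only [formulaCode] at h <;> try omega
    obtain ⟨h1, h2⟩ := Nat.pair_eq_pair.1
      (Nat.eq_of_mul_eq_mul_left (by norm_num : 0 < 4) (Nat.add_right_cancel h))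
    rw [termCode_injective h1, termCode_injective h2]
  | rel R ts =>
    intro ψ h
    cases R
    rcases ψ with _ | _ | ⟨⟨⟩, ts'⟩ | _ | _ <;> simp only [formulaCode] at h <;> try omega
    obtain ⟨h1, h2⟩ := Nat.pair_eq_pair.1
      (Nat.eq_of_mul_eq_mul_left (by norm_num : 0 < 4) (Nat.add_right_cancel h))
    congr 1
    funext k
    fin_cases k
    · exact termCode_injective h1
    · exact termCode_injective h2
  | imp φ₁ φ₂ ih₁ ih₂ =>
    intro ψ h
    rcases ψ with _ | _ | ⟨⟨⟩, ts⟩ | ⟨ψ₁, ψ₂⟩ | _ <;> simp only [formulaCode] at h <;> try omega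
    obtain ⟨h1, h2⟩ := Nat.pair_eq_pair.1
      (Nat.eq_of_mul_eq_mul_left (by norm_num : 0 < 4) (Nat.add_right_cancel h))
    rw [ih₁ h1, ih₂ h2]
  | all φ ih =>
    intro ψ h
    rcases ψ with _ | _ | ⟨⟨⟩, ts⟩ | _ | ψ <;> simp only [formulaCode] at h <;> try omega
    rw [ih (show formulaCode φ = formulaCode ψ by omega)]

/-- A set of sentences over `(L, ⊑, (w)_{w ∈ L})` is decidable if there is an algorithm that
decides whether a given natural number is the Gödel number of a member of the set. -/
def IsDecidableTheory {A : Type*} [Encodable A] {L : Language A}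
    (T : Set (subwordSignature L).Sentence) : Prop :=
  ComputablePred fun m : ℕ => ∃ φ ∈ T, formulaCode φ = m

/-! The theorem rests on a small model property: an existential sentence that holds in `L` has
witnesses whose lengths are bounded by a primitive recursive function of its code, so a finite
search decides it.

Two facts about an automaton for `L` give the bound. First, if all loops at each state on an
accepting run commuted, `L` would be bounded; hence some such state has loops `u`, `v` with `uv ≠
vu`. The words `U = uv` and `V = vu` have equal length and differ, so `X = U^M V^M` has no short
period. Bits, written as `U` or the empty word and separated by high powers of `X`, can then only be
embedded bit by bit: the cube `{0,1}^n`, and with it every partial order on `n` points, embeds into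
`L` among words as long as desired (`exists_cube_embedding`). Second, a nonempty loop missing a
letter could be pumped until that letter is rare; so every nonempty loop on an accepting run
contains every letter, and a word of `L` of length at least `K * |v|`, with `K` the number of
states, lies above `v` (`DFA.sublist_of_card_mul_length_le`).

Given `n` witnesses, there is a threshold `T` such that no witness has length in `(T, (K+1)T]`;
multiplying by `K+1` at most `n` times finds it. Short witnesses are kept, and long ones are
replaced by cube words with the same mutual order. The relations between long words and short words
or constants are forced: short lies strictly below long. So all atomic formulas keep their truth
values (`exists_short_sameType`). The rest checks that the search on codes is primitive recursive.
-/

/-! ### Powers of words -/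

section Words

variable {A : Type*}

/-- The `k`-th power of a word. -/
def wordPow (w : List A) : ℕ → List A
  | 0 => []
  | k + 1 => w ++ wordPow w k

theorem wordPow_add (w : List A) (i j : ℕ) : wordPow w (i + j) = wordPow w i ++ wordPow w j := by
  induction i with
  | zero => simp [wordPow]
  | succ i ih => simp [wordPow, Nat.succ_add, ih]

@[simp]
theorem length_wordPow (w : List A) (k : ℕ) : (wordPow w k).length = k * w.length := by
  induction k with
  | zero => simp [wordPow]
  | succ k ih => simp [wordPow, ih]; ring

theorem prefix_of_append_prefix_append {a b c d : List A} (h : a ++ b <+: c ++ d)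
    (hl : a.length = c.length) : a = c ∧ b <+: d := by
  obtain ⟨r, hr⟩ := h
  rw [List.append_assoc] at hr
  obtain ⟨h1, h2⟩ := List.append_inj hr hl
  exact ⟨h1, r, h2⟩

theorem prefix_wordPow_append {X t : List A} (h : X <+: t ++ X) (k : ℕ) :
    X <+: wordPow t k ++ X := by
  induction k with
  | zero => simp [wordPow]
  | succ k ih =>
    rw [wordPow, List.append_assoc]
    exact h.trans ((List.prefix_append_right_inj t).2 ih)

/-- A word `Uᴹ Vᴹ` with `|U| = |V|` and `U ≠ V` has no period between `1` and `M`. -/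
theorem eq_of_prefix_append {U V t : List A} {M : ℕ} (hlen : U.length = V.length)
    (ht : t ≠ []) (htM : t.length ≤ M)
    (h : wordPow U M ++ wordPow V M <+: t ++ (wordPow U M ++ wordPow V M)) : U = V := by
  have hd : 0 < t.length := List.length_pos_iff.2 ht
  -- The period `|t|` is iterated `|U|` times, so that the total shift has the length of `U ^ |t|`,
  -- a whole number of blocks. Comparing blocks then puts the first `V` against a `U`.
  have h1 := prefix_wordPow_append h U.length
  obtain ⟨e, rfl⟩ : ∃ e, M = t.length + e := ⟨M - t.length, by omega⟩
  have h2 : wordPow U t.length ++ (wordPow U e ++ wordPow V (t.length + e)) <+: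
      wordPow t U.length ++ (wordPow U (t.length + e) ++ wordPow V (t.length + e)) := by
    rw [← List.append_assoc, ← wordPow_add]
    exact h1
  have h3 := (prefix_of_append_prefix_append h2 (by simp [mul_comm])).2
  rw [add_comm t.length e, wordPow_add U e, List.append_assoc,
    List.prefix_append_right_inj] at h3
  obtain ⟨d, hd'⟩ : ∃ d, t.length = d + 1 := ⟨t.length - 1, by omega⟩
  rw [hd', show e + (d + 1) = (e + d) + 1 by omega] at h3
  simp only [wordPow, List.append_assoc] at h3
  exact (prefix_of_append_prefix_append h3 hlen.symm).1.symm

/-- If a word that is only slightly longer than `X ^ R ++ s` contains it as a subword, then one of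
the copies of `X` is embedded as a factor. -/
theorem exists_factor_of_wordPow_sublist {X s : List A} :
    ∀ {R : ℕ} {w : List A}, (wordPow X R ++ s).Sublist w →
      w.length < (wordPow X R ++ s).length + R →
      ∃ i j w₁ w₂, R = i + 1 + j ∧ w = w₁ ++ X ++ w₂ ∧ (wordPow X i).Sublist w₁ ∧
        (wordPow X j ++ s).Sublist w₂ := by
  intro R
  induction R with
  | zero =>
    intro w h hl
    have := h.length_le
    omega
  | succ R ih =>
    intro w h hl
    rw [wordPow, List.append_assoc, List.append_sublist_iff] at h
    obtain ⟨r₁, r₂, rfl, h₁, h₂⟩ := h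
    -- Either the piece `r₁` receiving the first copy of `X` equals it, or at least one letter is
    -- wasted; fewer than `R + 1` letters can be wasted in all.
    by_cases hr : X.length = r₁.length
    · exact ⟨0, R, [], r₂, by omega, by simp [h₁.eq_of_length hr], by simp [wordPow], h₂⟩
    · have := h₁.length_le
      simp only [wordPow, List.length_append, length_wordPow] at hl
      obtain ⟨i, j, w₁, w₂, rfl, rfl, h3, h4⟩ := ih h₂ (by
        simp only [List.length_append, length_wordPow]; omega)
      refine ⟨i + 1, j, r₁ ++ w₁, w₂, by omega, by simp, ?_, h4⟩
      exact h₁.append h3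

/-- If `X` has no period of length at most `d`, then the occurrences of `X` in a word have pairwise
distance greater than `d`. -/
theorem append_eq_append_of_no_period {X p₁ s₁ p₂ s₂ : List A} {d : ℕ}
    (hX : ∀ t : List A, t ≠ [] → t.length ≤ d → ¬ X <+: t ++ X)
    (h : p₁ ++ X ++ s₁ = p₂ ++ X ++ s₂) (h₁ : p₁.length ≤ p₂.length + d)
    (h₂ : p₂.length ≤ p₁.length + d) : p₁ = p₂ ∧ s₁ = s₂ := by
  have key : ∀ {p₁ s₁ p₂ s₂ : List A}, p₁ ++ X ++ s₁ = p₂ ++ X ++ s₂ →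
      p₁.length ≤ p₂.length → p₂.length ≤ p₁.length + d → p₁.length = p₂.length := by
    intro p₁ s₁ p₂ s₂ h hle hd
    have hp : p₁ <+: p₂ := by
      refine List.prefix_of_prefix_length_le (l₃ := p₁ ++ X ++ s₁) ?_ ?_ hle
      · rw [List.append_assoc]; exact List.prefix_append _ _
      · rw [h, List.append_assoc]; exact List.prefix_append _ _
    obtain ⟨t, rfl⟩ := hp
    by_contra hne
    have ht : t ≠ [] := by rintro rfl; simp at hne
    rw [List.length_append] at hd
    refine hX t ht (by omega) ?_
    simp only [List.append_assoc, List.append_cancel_left_eq] at h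
    refine List.prefix_of_prefix_length_le (l₃ := X ++ s₁) (List.prefix_append _ _) ?_ (by simp)
    rw [h, ← List.append_assoc]
    exact List.prefix_append _ _
  have hlen : p₁.length = p₂.length := by
    rcases le_total p₁.length p₂.length with hle | hle
    · exact key h hle h₂
    · exact (key h.symm hle h₁).symm
  simp only [List.append_assoc] at h
  obtain ⟨h3, h4⟩ := List.append_inj h hlen
  exact ⟨h3, List.append_cancel_left h4⟩

/-- Synchronisation: if `X` has no short period, then every embedding of `a ++ X ^ R ++ s` into a
word `b ++ X ^ R ++ s'` of roughly the same shape maps some copy of `X` to its counterpart. -/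
theorem exists_synchronized_split {X a b s s' : List A} {R D : ℕ}
    (hX : ∀ t : List A, t ≠ [] → t.length ≤ 2 * D → ¬ X <+: t ++ X) (hR : D < R)
    (hab : a.length ≤ b.length + D) (hba : b.length ≤ a.length + D)
    (hlen : (b ++ (wordPow X R ++ s')).length ≤ (a ++ (wordPow X R ++ s)).length + D)
    (h : (a ++ (wordPow X R ++ s)).Sublist (b ++ (wordPow X R ++ s'))) :
    ∃ i j, (a ++ wordPow X i).Sublist (b ++ wordPow X i) ∧
      (wordPow X j ++ s).Sublist (wordPow X j ++ s') := by
  obtain ⟨r₁, r₂, hr, h₁, h₂⟩ := List.append_sublist_iff.1 h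
  have hrl := congrArg List.length hr
  have hl1 := h₁.length_le
  simp only [List.length_append] at hrl hlen
  obtain ⟨i, j, w₁, w₂, rfl, rfl, h3, h4⟩ := exists_factor_of_wordPow_sublist h₂ (by
    simp only [List.length_append]; omega)
  have hsub1 : (a ++ wordPow X i).Sublist (r₁ ++ w₁) := h₁.append h3
  have hl3 := hsub1.length_le
  have hl4 := h4.length_le
  have e : wordPow X (i + 1 + j) = wordPow X i ++ X ++ wordPow X j := by
    rw [wordPow_add, wordPow_add]; simp [wordPow]
  rw [e] at hr hrl hlen
  simp only [List.length_append] at hrl hlen hl3 hl4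
  -- Since `a ++ X ^ i` fits into `r₁ ++ w₁` and `X ^ j ++ s` into `w₂`, the embedded factor starts
  -- at most `D` letters before and at most `2 * D` letters after its counterpart.
  obtain ⟨h5, h6⟩ := append_eq_append_of_no_period (p₁ := b ++ wordPow X i)
    (s₁ := wordPow X j ++ s') (p₂ := r₁ ++ w₁) (s₂ := w₂) hX
    (by simpa using hr) (by simp only [List.length_append]; omega)
    (by simp only [List.length_append]; omega)
  exact ⟨i, j, h5 ▸ hsub1, h6 ▸ h4⟩

/-! ### Words encoding bit lists -/

/-- The word encoding a list of bits: a bit is a possible occurrence of `U`, and consecutive bits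
are separated by `X ^ R`. -/
def bitWord (U X y : List A) (R : ℕ) : List Bool → List A
  | [] => y
  | b :: l => (bif b then U else []) ++ (wordPow X R ++ bitWord U X y R l)

theorem length_bitWord (U X y : List A) (R : ℕ) (l : List Bool) :
    (bitWord U X y R l).length =
      l.count true * U.length + l.length * (R * X.length) + y.length := by
  induction l with
  | nil => simp [bitWord]
  | cons b l ih => cases b <;> simp [bitWord, ih] <;> ring

theorem bitWord_sublist_of_le (U X y : List A) (R : ℕ) {l l' : List Bool}
    (h : List.Forall₂ (· ≤ ·) l l') : (bitWord U X y R l).Sublist (bitWord U X y R l') := by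
  induction h with
  | nil => simp
  | @cons b b' l l' hb _ ih =>
    simp only [bitWord]
    refine List.Sublist.append ?_ ((List.Sublist.refl _).append ih)
    cases b <;> cases b' <;> first | exact absurd hb (by decide) | simp

theorem le_of_bitWord_sublist {U X y : List A} {R D : ℕ} (hU : U ≠ [])
    (hX : ∀ t : List A, t ≠ [] → t.length ≤ 2 * D → ¬ X <+: t ++ X) (hR : D < R) :
    ∀ {l l' : List Bool} (z : List A), l.length = l'.length → l.length * U.length ≤ D →
      (z ++ bitWord U X y R l).Sublist (z ++ bitWord U X y R l') →
      List.Forall₂ (· ≤ ·) l l' := by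
  intro l
  induction l with
  | nil => intro l' z hl _ _; rw [List.eq_nil_of_length_eq_zero hl.symm]; exact .nil
  | cons b l ih =>
    intro l' z hl hD h
    obtain _ | ⟨b', l'⟩ := l'
    · simp at hl
    have hl' : l.length = l'.length := by simpa using hl
    have hc : l'.count true * U.length ≤ l.length * U.length := by
      rw [hl']; exact Nat.mul_le_mul_right _ List.count_le_length
    have hD' : U.length + l.length * U.length ≤ D := by
      rw [List.length_cons, Nat.succ_mul] at hD; omega
    simp only [bitWord, ← List.append_assoc z] at h
    -- The left half compares the first bits, by length alone. The right half is the induction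
    -- hypothesis with `X ^ j` as the new prefix `z`.
    obtain ⟨i, j, h1, h2⟩ := exists_synchronized_split hX hR
      (by cases b <;> cases b' <;> simp <;> omega) (by cases b <;> cases b' <;> simp <;> omega)
      (by
        simp only [List.length_append, length_bitWord, hl']
        cases b <;> cases b' <;> simp <;> omega) h
    refine .cons ?_ (ih _ hl' (by omega) h2)
    have h3 := h1.length_le
    have hU' := List.length_pos_iff.2 hU
    cases b <;> cases b' <;> simp at h3 ⊢
    exact absurd h3 hU

end Words

/-! ### Bounded languages -/

section Bounded

variable {A : Type*}

theorem one_le_prod_kstar (ws : List (List A)) :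
    (1 : Language A) ≤ (ws.map fun w => KStar.kstar ({w} : Language A)).prod := by
  induction ws with
  | nil => simp
  | cons w ws ih =>
    rw [List.map_cons, List.prod_cons]
    calc (1 : Language A) = 1 * 1 := (one_mul 1).symm
      _ ≤ _ := mul_le_mul' one_le_kstar ih

theorem IsBoundedLanguage.mono {L K : Language A} (hK : IsBoundedLanguage K) (h : L ≤ K) :
    IsBoundedLanguage L := by
  obtain ⟨ws, hw⟩ := hK
  exact ⟨ws, h.trans hw⟩

theorem IsBoundedLanguage.mul {L K : Language A} (hL : IsBoundedLanguage L)
    (hK : IsBoundedLanguage K) : IsBoundedLanguage (L * K) := by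
  obtain ⟨ws, hw⟩ := hL
  obtain ⟨vs, hv⟩ := hK
  refine ⟨ws ++ vs, ?_⟩
  rw [List.map_append, List.prod_append]
  exact mul_le_mul' hw hv

theorem IsBoundedLanguage.add {L K : Language A} (hL : IsBoundedLanguage L)
    (hK : IsBoundedLanguage K) : IsBoundedLanguage (L + K) := by
  obtain ⟨ws, hw⟩ := hL
  obtain ⟨vs, hv⟩ := hK
  refine ⟨ws ++ vs, ?_⟩
  rw [List.map_append, List.prod_append]
  refine add_le ?_ ?_
  · calc L = L * 1 := (mul_one L).symm
      _ ≤ _ := mul_le_mul' hw (one_le_prod_kstar vs)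
  · calc K = 1 * K := (one_mul K).symm
      _ ≤ _ := mul_le_mul' (one_le_prod_kstar ws) hv

theorem isBoundedLanguage_kstar (w : List A) : IsBoundedLanguage (KStar.kstar ({w} : Language A)) :=
  ⟨[w], by simp⟩

theorem isBoundedLanguage_singleton (w : List A) : IsBoundedLanguage ({w} : Language A) :=
  (isBoundedLanguage_kstar w).mono le_kstar

theorem isBoundedLanguage_zero : IsBoundedLanguage (0 : Language A) :=
  (isBoundedLanguage_singleton []).mono (zero_le)

theorem isBoundedLanguage_sum {ι : Type*} (s : Finset ι) (f : ι → Language A)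
    (h : ∀ i, IsBoundedLanguage (f i)) : IsBoundedLanguage (∑ i ∈ s, f i) := by
  classical
  induction s using Finset.induction_on with
  | empty => simpa using isBoundedLanguage_zero
  | insert i s hi ih => rw [Finset.sum_insert hi]; exact (h i).add ih

/-- The words commuting with a given nonempty word are the powers of a single word. -/
theorem exists_kstar_of_commute {u : List A} (hu : u ≠ []) :
    ∃ w : List A, ∀ v : List A, u ++ v = v ++ u → v ∈ KStar.kstar ({w} : Language A) := by
  classical
  have hex : ∃ n, ∃ w : List A, w ≠ [] ∧ u ++ w = w ++ u ∧ w.length = n :=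
    ⟨_, u, hu, rfl, rfl⟩
  obtain ⟨w, hw, huw, hlen⟩ := Nat.find_spec hex
  have hmin : ∀ v : List A, v ≠ [] → u ++ v = v ++ u → w.length ≤ v.length := by
    intro v hv huv
    rw [hlen]
    exact Nat.find_min' hex ⟨v, hv, huv, rfl⟩
  have hpow : ∀ (v : List A), u ++ v = v ++ u → ∀ k, v <+: wordPow u k ++ v := by
    intro v hv k
    exact prefix_wordPow_append (hv ▸ List.prefix_append v u) k
  refine ⟨w, ?_⟩
  suffices H : ∀ n, ∀ v : List A, v.length = n → u ++ v = v ++ u →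
      v ∈ KStar.kstar ({w} : Language A) from fun v hv => H _ v rfl hv
  intro n
  induction n using Nat.strong_induction_on with
  | _ n ih =>
    intro v hv huv
    by_cases hv0 : v = []
    · subst hv0; exact Language.nil_mem_kstar _
    have hle := hmin v hv0 huv
    have hup : 0 < u.length := List.length_pos_iff.2 hu
    -- Every word commuting with `u` is a prefix of a power of `u`, so the shortest nonempty one,
    -- `w`, is a prefix of `v`. What remains of `v` again commutes with `u`.
    have hwv : w <+: v := by
      have hk : ∀ x : List A, u ++ x = x ++ u → x.length ≤ v.length →
          x <+: wordPow u v.length := by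
        intro x hx hxl
        refine List.prefix_of_prefix_length_le (hpow x hx v.length) (List.prefix_append _ _) ?_
        rw [length_wordPow]
        exact hxl.trans (Nat.le_mul_of_pos_right _ hup)
      exact List.prefix_of_prefix_length_le (hk w huw hle) (hk v huv le_rfl) hle
    obtain ⟨v', rfl⟩ := hwv
    have hwp : 0 < w.length := List.length_pos_iff.2 hw
    have h1 : u ++ v' = v' ++ u := by
      rw [← List.append_assoc, huw, List.append_assoc, List.append_assoc] at huv
      exact List.append_cancel_left huv
    have h2 := ih v'.length (by rw [← hv, List.length_append]; omega) v' rfl h1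
    rw [Language.mem_kstar] at h2 ⊢
    obtain ⟨S, rfl, hS⟩ := h2
    refine ⟨w :: S, by simp, ?_⟩
    intro y hy
    rcases List.mem_cons.1 hy with rfl | hy
    · rfl
    · exact hS y hy

/-- Used to cut a run at its last visit to a state: `P u` says that reading `u` leads back to it. -/
theorem exists_maximal_prefix (P : List A → Prop) (w : List A) (h : P []) :
    ∃ u r, w = u ++ r ∧ P u ∧ ∀ s, s ≠ [] → s <+: r → ¬ P (u ++ s) := by
  suffices H : ∀ n (r u : List A), r.length = n → P u → ∃ u' r', u ++ r = u' ++ r' ∧ P u' ∧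
      ∀ s, s ≠ [] → s <+: r' → ¬ P (u' ++ s) from H _ w [] rfl h
  intro n
  induction n using Nat.strong_induction_on with
  | _ n ih =>
    intro r u hr hu
    by_cases hs : ∃ s, s ≠ [] ∧ s <+: r ∧ P (u ++ s)
    · obtain ⟨s, hs, ⟨r', rfl⟩, hP⟩ := hs
      have := List.length_pos_iff.2 hs
      obtain ⟨u', r'', h1, h2⟩ := ih r'.length (by rw [← hr, List.length_append]; omega) r'
        (u ++ s) rfl hP
      exact ⟨u', r'', by rw [← h1, List.append_assoc], h2⟩
    · push Not at hs
      exact ⟨u, r, rfl, hu, hs⟩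

end Bounded

/-! ### Loops of automata -/

namespace DFA

variable {A σ : Type*} (M : DFA A σ)

/-- A state is useful if it lies on an accepting run. -/
def IsUseful (q : σ) : Prop :=
  (∃ x, M.eval x = q) ∧ ∃ y, M.evalFrom q y ∈ M.accept

/-- The words accepted from `q` by a run inside `S`. -/
def acceptsWithin (S : Finset σ) (q : σ) : Language A :=
  {w | M.evalFrom q w ∈ M.accept ∧ ∀ u, u <+: w → M.evalFrom q u ∈ S}

/-- Cut an accepting run from `q` at its last visit to `q`. The part before is a loop, hence a power
of one word; the part after its first letter avoids `q` and so stays in `S.erase q`, where induction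
applies. -/
theorem isBoundedLanguage_acceptsWithin [Finite A] [DecidableEq σ]
    (H : ∀ q, M.IsUseful q → ∃ w : List A, ∀ v : List A, M.evalFrom q v = q →
      v ∈ KStar.kstar ({w} : Language A)) (S : Finset σ) :
    ∀ q, (∃ x, M.eval x = q) → IsBoundedLanguage (M.acceptsWithin S q) := by
  have := Fintype.ofFinite A
  induction S using Finset.strongInduction with
  | H S ih =>
    intro q hq
    by_cases hne : ∃ y, y ∈ M.acceptsWithin S q
    swap
    · refine isBoundedLanguage_zero.mono ?_
      intro w hw
      exact absurd ⟨w, hw⟩ hne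
    obtain ⟨y, hy, hyS⟩ := hne
    have hqS : q ∈ S := hyS [] List.nil_prefix
    obtain ⟨w, hw⟩ := H q ⟨hq, y, hy⟩
    have hb : ∀ a : A, IsBoundedLanguage (M.acceptsWithin (S.erase q) (M.step q a)) := by
      intro a
      refine ih _ (Finset.erase_ssubset hqS) _ ?_
      obtain ⟨x, rfl⟩ := hq
      exact ⟨x ++ [a], M.eval_append_singleton x a⟩
    refine ((isBoundedLanguage_kstar w).mul ((isBoundedLanguage_singleton []).add
      (isBoundedLanguage_sum Finset.univ _ fun a =>
        (isBoundedLanguage_singleton [a]).mul (hb a)))).mono ?_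
    rintro v ⟨hv, hvS⟩
    obtain ⟨u, r, rfl, hu, hr⟩ := exists_maximal_prefix (fun u => M.evalFrom q u = q) v rfl
    refine Language.mem_mul.2 ⟨u, hw u hu, r, ?_, rfl⟩
    rw [Language.mem_add]
    obtain _ | ⟨a, r⟩ := r
    · exact Or.inl rfl
    right
    have hle : ({[a]} : Language A) * M.acceptsWithin (S.erase q) (M.step q a) ≤
        ∑ a : A, ({[a]} : Language A) * M.acceptsWithin (S.erase q) (M.step q a) :=
      Finset.single_le_sum
        (f := fun a => ({[a]} : Language A) * M.acceptsWithin (S.erase q) (M.step q a))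
        (fun _ _ => zero_le) (Finset.mem_univ a)
    refine hle (Language.mem_mul.2 ⟨[a], rfl, r, ⟨?_, ?_⟩, rfl⟩)
    · rw [M.evalFrom_of_append, hu] at hv
      exact hv
    · intro s hs
      have h1 : a :: s <+: a :: r := (List.prefix_cons_inj a).2 hs
      have h2 := hvS (u ++ a :: s) ((List.prefix_append_right_inj u).2 h1)
      have h3 := hr (a :: s) (by simp) h1
      rw [M.evalFrom_of_append, hu] at h2 h3
      exact Finset.mem_erase.2 ⟨h3, h2⟩

/-- An automaton with an unbounded language has a useful state with two loops that do not
commute. -/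
theorem exists_not_commute_of_not_isBoundedLanguage [Finite A] [Fintype σ]
    (h : ¬ IsBoundedLanguage M.accepts) :
    ∃ q, M.IsUseful q ∧ ∃ u v, M.evalFrom q u = q ∧ M.evalFrom q v = q ∧ u ++ v ≠ v ++ u := by
  classical
  by_contra! hc
  refine h ((M.isBoundedLanguage_acceptsWithin ?_ Finset.univ M.start ⟨[], rfl⟩).mono
    fun w hw => ⟨hw, fun _ _ => Finset.mem_univ _⟩)
  intro q hq
  by_cases hu : ∃ u, u ≠ [] ∧ M.evalFrom q u = q
  · obtain ⟨u, hu, hloop⟩ := hu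
    obtain ⟨w, hw⟩ := exists_kstar_of_commute hu
    exact ⟨w, fun v hv => hw v (hc q hq u v hloop hv)⟩
  · push Not at hu
    refine ⟨[], fun v hv => ?_⟩
    have : v = [] := by
      by_contra hv0
      exact hu v hv0 hv
    rw [this]
    exact Language.nil_mem_kstar _

variable {M}

theorem evalFrom_wordPow {q : σ} {u : List A} (h : M.evalFrom q u = q) (k : ℕ) :
    M.evalFrom q (wordPow u k) = q := by
  induction k with
  | zero => rfl
  | succ k ih => rw [wordPow, M.evalFrom_of_append, h, ih]

/-- If every letter is frequent, every nonempty loop at a useful state contains every letter. -/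
theorem mem_of_loop [DecidableEq A] (hfreq : HasNonNegligibleLetters M.accepts) {q : σ}
    (hq : M.IsUseful q) {u : List A} (hu : u ≠ []) (hloop : M.evalFrom q u = q) (a : A) :
    a ∈ u := by
  by_contra ha
  obtain ⟨ε, hε, hfin⟩ := hfreq
  obtain ⟨⟨x, hx⟩, y, hy⟩ := hq
  have hup : 0 < u.length := List.length_pos_iff.2 hu
  have hcount : ∀ k, (wordPow u k).count a = 0 := by
    intro k
    induction k with
    | zero => simp [wordPow]
    | succ k ih => rw [wordPow, List.count_append, ih, List.count_eq_zero_of_not_mem ha]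
  -- Pumping `u` leaves the number of occurrences of `a` at that of `x` and `y`, so any length of at
  -- least this `N` forces a frequency of at most `ε`.
  obtain ⟨N, hN⟩ := exists_nat_gt (((x.count a + y.count a : ℕ) : ℝ) / ε)
  have hinj : Function.Injective fun k => x ++ (wordPow u (N + k) ++ y) := by
    intro k k' h
    have := congrArg List.length h
    simp only [List.length_append, length_wordPow] at this
    have h2 : (N + k) * u.length = (N + k') * u.length := by omega
    have := Nat.eq_of_mul_eq_mul_right hup h2
    omega
  refine Set.infinite_of_injective_forall_mem hinj ?_ (hfin a)
  intro k
  refine ⟨?_, not_lt.2 ?_⟩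
  · rw [M.mem_accepts, DFA.eval, M.evalFrom_of_append, M.evalFrom_of_append]
    rw [DFA.eval] at hx
    rw [hx, evalFrom_wordPow hloop]
    exact hy
  · have hlen : N ≤ (x ++ (wordPow u (N + k) ++ y)).length := by
      simp only [List.length_append, length_wordPow]
      have := Nat.le_mul_of_pos_right (N + k) hup
      omega
    have hlen' : (N : ℝ) ≤ ((x ++ (wordPow u (N + k) ++ y)).length : ℝ) := by exact_mod_cast hlen
    have hc : (x ++ (wordPow u (N + k) ++ y)).count a = x.count a + y.count a := by
      simp [List.count_append, hcount]
    have hN0 : (0 : ℝ) < N := lt_of_le_of_lt (by positivity) hN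
    rw [hc, div_le_iff₀ (hN0.trans_le hlen')]
    rw [div_lt_iff₀ hε] at hN
    nlinarith

/-- If every nonempty loop at a useful state contains every letter, long accepted words contain
all short words. -/
theorem sublist_of_card_mul_length_le [Fintype σ]
    (hloop : ∀ q, M.IsUseful q → ∀ u, u ≠ [] → M.evalFrom q u = q → ∀ a, a ∈ u)
    {v w : List A} (hw : w ∈ M.accepts) (h : Fintype.card σ * v.length ≤ w.length) :
    v.Sublist w := by
  suffices H : ∀ v w : List A, ∀ q, (∃ x, M.eval x = q) → M.evalFrom q w ∈ M.accept →
      Fintype.card σ * v.length ≤ w.length → v.Sublist w from H v w M.start ⟨[], rfl⟩ hw h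
  intro v
  induction v with
  | nil => intro w _ _ _ _; exact List.nil_sublist w
  | cons a v ih =>
    intro w q hq hw hl
    rw [List.length_cons, Nat.mul_succ] at hl
    -- A loop `u` is completed within the first `card σ` letters. It supplies the letter `a`, and
    -- the remaining `y` is still long enough for the rest of `v`.
    obtain ⟨q', x, u, y, rfl, hlen, hu, hx, hu', hy⟩ :=
      M.evalFrom_split (s := q) (x := w) (by omega) rfl
    have hq' : ∃ x, M.eval x = q' := by
      obtain ⟨x', rfl⟩ := hq
      exact ⟨x' ++ x, by rw [DFA.eval, M.evalFrom_of_append]; exact hx⟩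
    rw [← hy] at hw
    have ha := hloop q' ⟨hq', y, hw⟩ u hu hu' a
    have hv := ih y q' hq' hw (by simp only [List.length_append] at hl; omega)
    have h1 : [a].Sublist (x ++ u) :=
      (List.singleton_sublist.2 ha).trans (List.sublist_append_right x u)
    exact h1.append hv

end DFA

/-! ### Small models -/

section SmallModels

variable {A : Type*}

/-- A bound for the length of the words that encode bit lists of length `n` and have length at
least `N`. -/
def embedBound (p s n N : ℕ) : ℕ :=
  s + n * p + n * ((n * p + 1 + N) * (2 * ((2 * (n * p) + 1) * p)))

theorem embedBound_mono {p s n N N' : ℕ} (h : N ≤ N') : embedBound p s n N ≤ embedBound p s n N' := by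
  unfold embedBound
  gcongr

theorem forall₂_ofFn {n : ℕ} {f g : Fin n → Bool} :
    List.Forall₂ (· ≤ ·) (List.ofFn f) (List.ofFn g) ↔ ∀ i, f i ≤ g i := by
  rw [List.forall₂_iff_get]
  constructor
  · rintro ⟨_, h⟩ i
    simpa using h i (by simp) (by simp)
  · intro h
    exact ⟨by simp, fun i hi _ => by simpa using h ⟨i, by simpa using hi⟩⟩

/-- The cubes `{0, 1}ⁿ` embed into every unbounded regular language. -/
theorem exists_cube_embedding [Finite A] {L : Language A} (hreg : L.IsRegular)
    (hunb : ¬ IsBoundedLanguage L) :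
    ∃ p s, ∀ n N, 0 < n → ∃ W : List Bool → List A,
      (∀ l, l.length = n → W l ∈ L ∧ N ≤ (W l).length ∧ (W l).length ≤ embedBound p s n N) ∧
      ∀ l l', l.length = n → l'.length = n →
        ((W l).Sublist (W l') ↔ List.Forall₂ (· ≤ ·) l l') := by
  obtain ⟨σ, _, M, rfl⟩ := hreg
  obtain ⟨q, ⟨⟨x, hx⟩, y, hy⟩, u, v, hu, hv, huv⟩ :=
    M.exists_not_commute_of_not_isBoundedLanguage hunb
  set U := u ++ v with hU
  set V := v ++ u with hV
  have hUV : U.length = V.length := by simp [hU, hV, add_comm]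
  have hU0 : U ≠ [] := by
    intro h
    rw [hU, List.append_eq_nil_iff] at h
    exact huv (by rw [hU, hV, h.1, h.2])
  have hUp : 0 < U.length := List.length_pos_iff.2 hU0
  have hUq : M.evalFrom q U = q := by rw [hU, M.evalFrom_of_append, hu, hv]
  have hVq : M.evalFrom q V = q := by rw [hV, M.evalFrom_of_append, hv, hu]
  -- The constants of `embedBound`: `p = |U|` and `s = |x| + |y|`. In the exponent `D + 1 + N` of
  -- `X`, the summand `D + 1` serves synchronisation and `N` makes the words long. The exponent `2 *
  -- D + 1` inside `X` excludes periods up to `2 * D`.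
  refine ⟨U.length, x.length + y.length, fun n N hn => ?_⟩
  set D := n * U.length with hD
  set X := wordPow U (2 * D + 1) ++ wordPow V (2 * D + 1) with hX
  have hXlen : X.length = 2 * ((2 * D + 1) * U.length) := by
    rw [hX, List.length_append, length_wordPow, length_wordPow, ← hUV]; ring
  have hXq : M.evalFrom q X = q := by
    rw [hX, M.evalFrom_of_append, DFA.evalFrom_wordPow hUq, DFA.evalFrom_wordPow hVq]
  refine ⟨fun l => x ++ bitWord U X y (D + 1 + N) l, ?_, ?_⟩
  · intro l hl
    have hacc : M.evalFrom q (bitWord U X y (D + 1 + N) l) ∈ M.accept := by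
      clear hl
      induction l with
      | nil => exact hy
      | cons b l ih =>
        rw [bitWord, M.evalFrom_of_append, M.evalFrom_of_append]
        have : M.evalFrom q (bif b then U else []) = q := by cases b <;> simp [hUq]
        rw [this, DFA.evalFrom_wordPow hXq]
        exact ih
    have hcount : l.count true * U.length ≤ n * U.length :=
      Nat.mul_le_mul_right _ (hl ▸ List.count_le_length)
    refine ⟨?_, ?_, ?_⟩
    · rw [M.mem_accepts, DFA.eval, M.evalFrom_of_append]
      rw [DFA.eval] at hx
      rwa [hx]
    · rw [List.length_append, length_bitWord, hl]
      have hXp : 0 < X.length := by rw [hXlen]; positivity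
      have h1 : N ≤ (D + 1 + N) * X.length :=
        (Nat.le_add_left _ _).trans (Nat.le_mul_of_pos_right _ hXp)
      have h2 := h1.trans (Nat.le_mul_of_pos_left _ hn)
      omega
    · rw [List.length_append, length_bitWord, hl, hXlen, embedBound, ← hD]
      omega
  · intro l l' hl hl'
    constructor
    · intro h
      refine le_of_bitWord_sublist (R := D + 1 + N) (D := D) hU0 ?_ (by omega) x
        (hl.trans hl'.symm) (by rw [hl]) h
      intro t ht htD hp
      exact huv (eq_of_prefix_append hUV ht (by omega) hp)
    · intro h
      exact (List.Sublist.refl x).append (bitWord_sublist_of_le U X y _ h)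

/-! ### Replacing long witnesses by short ones -/

/-- Two families of words satisfy the same atomic formulas with words of length at most `N` as
parameters. -/
def SameType {n : ℕ} (N : ℕ) (x x' : Fin n → List A) : Prop :=
  (∀ i j, (x i).Sublist (x j) ↔ (x' i).Sublist (x' j)) ∧
    ∀ i c, c.length ≤ N → ((x i).Sublist c ↔ (x' i).Sublist c) ∧ (c.Sublist (x i) ↔ c.Sublist (x' i))

theorem SameType.mono {n N N' : ℕ} {x x' : Fin n → List A} (h : SameType N' x x') (hN : N ≤ N') :
    SameType N x x' :=
  ⟨h.1, fun i c hc => h.2 i c (hc.trans hN)⟩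

/-- If long words of `L` lie above all short words, then the words of a family that are long can
be replaced by the words of an embedded cube. -/
theorem exists_sameType_of_gap {L : Language A} {K B n N : ℕ} {W : List Bool → List A}
    (hK : ∀ v w : List A, w ∈ L → K * v.length ≤ w.length → v.Sublist w)
    (hW : ∀ l, l.length = n → W l ∈ L ∧ (K + 1) * N + 1 ≤ (W l).length ∧ (W l).length ≤ B)
    (hWW : ∀ l l', l.length = n → l'.length = n →
        ((W l).Sublist (W l') ↔ List.Forall₂ (· ≤ ·) l l'))
    (hNB : N ≤ B) (x : Fin n → List A) (hx : ∀ i, x i ∈ L)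
    (hgap : ∀ i, N < (x i).length → (K + 1) * N < (x i).length) :
    ∃ x' : Fin n → List A, (∀ i, x' i ∈ L ∧ (x' i).length ≤ B) ∧ SameType N x x' := by
  classical
  -- Each `x i` is represented by its down-set among all `x j`: inclusion of down-sets is the order,
  -- by reflexivity and transitivity.
  set l : Fin n → List Bool := fun i => List.ofFn fun j => decide ((x j).Sublist (x i)) with hl
  have hln : ∀ i, (l i).length = n := fun i => by simp [hl]
  have hbig : ∀ w c : List A, w ∈ L → (K + 1) * N < w.length → c.length ≤ N →
      c.Sublist w ∧ ¬ w.Sublist c := by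
    intro w c hw hwl hc
    constructor
    · refine hK c w hw ((Nat.mul_le_mul_left K hc).trans ?_)
      rw [Nat.succ_mul] at hwl
      omega
    · intro h
      have := h.length_le
      rw [Nat.succ_mul] at hwl
      omega
  have hbig' : ∀ i c, c.length ≤ N → c.Sublist (W (l i)) ∧ ¬ (W (l i)).Sublist c := fun i c hc =>
    hbig _ c (hW _ (hln i)).1 (hW _ (hln i)).2.1 hc
  have hll : ∀ i j, (W (l i)).Sublist (W (l j)) ↔ (x i).Sublist (x j) := by
    intro i j
    rw [hWW _ _ (hln i) (hln j), hl, forall₂_ofFn]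
    constructor
    · intro h
      have := h i
      simpa [Bool.le_iff_imp] using this
    · intro h k
      rw [Bool.le_iff_imp]
      simp only [decide_eq_true_eq]
      exact fun hk => hk.trans h
  refine ⟨fun i => if (x i).length ≤ N then x i else W (l i), ?_, ?_, ?_⟩
  · intro i
    by_cases hi : (x i).length ≤ N
    · simp only [hi, if_true]; exact ⟨hx i, hi.trans hNB⟩
    · simp only [hi, if_false]; exact ⟨(hW _ (hln i)).1, (hW _ (hln i)).2.2⟩
  · intro i j
    by_cases hi : (x i).length ≤ N <;> by_cases hj : (x j).length ≤ N <;>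
      simp only [hi, hj, if_true, if_false]
    · have h1 := hbig (x j) (x i) (hx j) (hgap j (by omega)) hi
      have h2 := hbig' j (x i) hi
      tauto
    · have h1 := hbig (x i) (x j) (hx i) (hgap i (by omega)) hj
      have h2 := hbig' i (x j) hj
      tauto
    · exact (hll i j).symm
  · intro i c hc
    by_cases hi : (x i).length ≤ N <;> simp only [hi, if_true, if_false]
    · tauto
    · have h1 := hbig (x i) c (hx i) (hgap i (by omega)) hc
      have h2 := hbig' i c hc
      tauto

/-- A bound for the length of the words in a small model with `n` elements and parameters of
length at most `N`. -/
def modelBound (K p s n N : ℕ) : ℕ :=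
  N * (K + 1) ^ n + embedBound p s n ((K + 1) * (N * (K + 1) ^ n) + 1)

/-- The small model property. Whenever some word is too long to be short and too short to be long,
the threshold `N` is raised to `(K + 1) * N`; that word then counts as short, so this happens at
most `n` times. -/
theorem exists_short_sameType [Finite A] [DecidableEq A] {L : Language A} (hreg : L.IsRegular)
    (hunb : ¬ IsBoundedLanguage L) (hfreq : HasNonNegligibleLetters L) :
    ∃ K p s, ∀ n N (x : Fin n → List A), (∀ i, x i ∈ L) → ∃ x' : Fin n → List A,
      (∀ i, x' i ∈ L ∧ (x' i).length ≤ modelBound K p s n N) ∧ SameType N x x' := by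
  obtain ⟨p, s, hW⟩ := exists_cube_embedding hreg hunb
  obtain ⟨σ, _, M, rfl⟩ := hreg
  have hK : ∀ v w : List A, w ∈ M.accepts → Fintype.card σ * v.length ≤ w.length → v.Sublist w :=
    fun v w => DFA.sublist_of_card_mul_length_le
      (fun q hq u hu hloop a => DFA.mem_of_loop hfreq hq hu hloop a)
  generalize Fintype.card σ = K at hK
  refine ⟨K, p, s, fun n N x hx => ?_⟩
  rcases Nat.eq_zero_or_pos n with rfl | hn
  · exact ⟨x, fun i => i.elim0, fun i => i.elim0, fun i => i.elim0⟩
  -- `F` bounds every threshold still reachable: `k` counts the words longer than `N`, and each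
  -- raise multiplies `N` by `K + 1` while decreasing `k`.
  suffices H : ∀ F k N (x : Fin n → List A), (∀ i, x i ∈ M.accepts) →
      (Finset.univ.filter fun i => N < (x i).length).card = k → N * (K + 1) ^ k ≤ F →
      ∃ x' : Fin n → List A,
        (∀ i, x' i ∈ M.accepts ∧ (x' i).length ≤ F + embedBound p s n ((K + 1) * F + 1)) ∧
        SameType N x x' by
    refine H _ _ N x hx rfl (Nat.mul_le_mul_left _ (Nat.pow_le_pow_right (by omega) ?_))
    exact (Finset.card_le_univ _).trans (by simp)
  intro F k
  induction k using Nat.strong_induction_on with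
  | _ k ih =>
    intro N x hx hk hF
    have hNF : N ≤ F := (Nat.le_mul_of_pos_right _ (by positivity)).trans hF
    by_cases hgap : ∀ i, N < (x i).length → (K + 1) * N < (x i).length
    · obtain ⟨W, hW1, hW2⟩ := hW n ((K + 1) * N + 1) hn
      refine exists_sameType_of_gap hK (fun l hl => ?_) hW2 (by omega) x hx hgap
      obtain ⟨h1, h2, h3⟩ := hW1 l hl
      refine ⟨h1, h2, h3.trans ?_⟩
      have : embedBound p s n ((K + 1) * N + 1) ≤ embedBound p s n ((K + 1) * F + 1) :=
        embedBound_mono (by gcongr)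
      omega
    · push Not at hgap
      obtain ⟨i, hi1, hi2⟩ := hgap
      have hN : N ≤ (K + 1) * N := Nat.le_mul_of_pos_left _ (by omega)
      have hlt : (Finset.univ.filter fun j => (K + 1) * N < (x j).length).card < k := by
        rw [← hk]
        refine Finset.card_lt_card ⟨fun j hj => ?_, fun h => ?_⟩
        · simp only [Finset.mem_filter, Finset.mem_univ, true_and] at hj ⊢
          omega
        · have := h (Finset.mem_filter.2 ⟨Finset.mem_univ i, hi1⟩)
          simp only [Finset.mem_filter, Finset.mem_univ, true_and] at this
          omega
      obtain ⟨x', h1, h2⟩ := ih _ hlt ((K + 1) * N) x hx rfl (by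
        refine le_trans ?_ hF
        calc (K + 1) * N * (K + 1) ^ _ = N * (K + 1) ^ (_ + 1) := by ring
          _ ≤ N * (K + 1) ^ k := Nat.mul_le_mul_left _ (Nat.pow_le_pow_right (by omega) hlt))
      exact ⟨x', h1, h2.mono hN⟩

end SmallModels

/-! ### Words as lists of numbers -/

section Codes

open Encodable

/-- Allows computation with lists of numbers instead of words: every number codes a list in `List
ℕ`, whereas not every number need code a word over `A`. -/
theorem encode_map_encode {A : Type*} [Encodable A] (w : List A) :
    encode (w.map (encode : A → ℕ)) = encode w := by
  induction w with
  | nil => rfl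
  | cons a w ih => rw [List.map_cons, encode_list_cons, encode_list_cons, ih, encode_nat]

theorem ofNat_encode_list {A : Type*} [Encodable A] (w : List A) :
    Denumerable.ofNat (List ℕ) (encode w) = w.map encode := by
  rw [← encode_map_encode, Denumerable.ofNat_encode]

theorem map_encode_sublist {A : Type*} [Encodable A] {u v : List A} :
    (u.map (encode : A → ℕ)).Sublist (v.map encode) ↔ u.Sublist v := by
  constructor
  · intro h
    obtain ⟨u', hu', h⟩ := List.sublist_map_iff.1 h
    rwa [List.map_injective_iff.2 encode_injective h]
  · exact fun h => h.map _

/-- The step of a greedy search for a subword: the first letter still to be found is removed. -/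
def removeHead (u : List ℕ) (b : ℕ) : List ℕ :=
  if u.head? = some b then u.tail else u

theorem foldl_removeHead_eq_nil {u v : List ℕ} : v.foldl removeHead u = [] ↔ u.Sublist v := by
  induction v generalizing u with
  | nil => simp
  | cons b v ih =>
    rw [List.foldl_cons, ih]
    obtain _ | ⟨a, u⟩ := u
    · simp [removeHead]
    · by_cases h : a = b
      · subst h; simp [removeHead]
      · simp only [removeHead, List.head?_cons, Option.some.injEq, h, if_false]
        exact ⟨fun h => h.cons b, fun h' => by
          cases h' with
          | cons _ h' => exact h'
          | cons_cons _ _ => exact absurd rfl h⟩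

theorem primrecRel_sublist : PrimrecRel fun u v : List ℕ => u.Sublist v := by
  have hstep : Primrec₂ removeHead := by
    refine Primrec.ite ?_ (Primrec.list_tail.comp Primrec.fst) Primrec.fst
    exact Primrec.eq.comp (Primrec.list_head?.comp Primrec.fst)
      (Primrec.option_some.comp Primrec.snd)
  have hfold : Primrec fun p : List ℕ × List ℕ => p.2.foldl removeHead p.1 :=
    Primrec.list_foldl Primrec.snd Primrec.fst
      (hstep.comp (Primrec.fst.comp Primrec.snd) (Primrec.snd.comp Primrec.snd)).to₂
  exact (Primrec.eq.comp hfold (Primrec.const [])).of_eq fun p => foldl_removeHead_eq_nil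

/-- The codes of the words of a regular language form a primitive recursive set. -/
theorem primrecPred_mem_of_isRegular {A : Type*} [Finite A] [Encodable A] {L : Language A}
    (hreg : L.IsRegular) :
    PrimrecPred fun l : List ℕ => ∃ w ∈ L, w.map encode = l := by
  classical
  obtain ⟨σ, _, M, rfl⟩ := hreg
  let _ : Primcodable σ := Primcodable.ofEquiv (Fin (Fintype.card σ)) (Fintype.equivFin σ)
  obtain ⟨B, hB⟩ : ∃ B, ∀ a : A, encode a < B := by
    obtain ⟨B, hB⟩ := (Set.finite_range (encode : A → ℕ)).bddAbove
    exact ⟨B + 1, fun a => Nat.lt_succ_of_le (hB ⟨a, rfl⟩)⟩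
  -- Letter codes are below `B`, so a transition is a map between finite types and automatically
  -- primitive recursive. `decode₂` rejects numbers that are not the code of the letter they decode
  -- to.
  let F : Option σ × Fin B → Option σ := fun p =>
    p.1.bind fun q => (decode₂ A p.2).map (M.step q)
  let step : Option σ → ℕ → Option σ := fun s c => ((List.finRange B)[c]?).bind fun b => F (s, b)
  have hstep : Primrec₂ step := by
    refine Primrec.option_bind ((Primrec.list_getElem?₁ (List.finRange B)).comp Primrec.snd) ?_
    exact ((Primrec.dom_finite F).comp
      (Primrec.pair (Primrec.fst.comp Primrec.fst) Primrec.snd)).to₂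
  have hstep' : ∀ q c, step (some q) c = (decode₂ A c).map (M.step q) := by
    intro q c
    by_cases hc : c < B
    · simp [step, F, hc]
    · have : decode₂ A c = none := by
        rw [Option.eq_none_iff_forall_ne_some]
        intro a ha
        exact hc (mem_decode₂.1 ha ▸ hB a)
      simp [step, this, not_lt.1 hc]
  have hnone : ∀ l : List ℕ, l.foldl step none = none := by
    intro l
    induction l with
    | nil => rfl
    | cons c l ih =>
      have : step none c = none := by simp [step, F]
      rw [List.foldl_cons, this, ih]
  have hrun : ∀ (l : List ℕ) (q : σ), (∃ w, M.evalFrom q w ∈ M.accept ∧ w.map encode = l) ↔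
      ∃ q' ∈ M.accept, l.foldl step (some q) = some q' := by
    intro l
    induction l with
    | nil => intro q; simp
    | cons c l ih =>
      intro q
      rw [List.foldl_cons, hstep']
      rcases hd : decode₂ A c with _ | a
      · simp only [Option.map_none, hnone, reduceCtorEq, and_false, exists_false, iff_false]
        rintro ⟨_ | ⟨a, w⟩, _, h⟩
        · simp at h
        · rw [List.map_cons, List.cons.injEq] at h
          have := mem_decode₂.2 h.1
          rw [hd] at this
          simp at this
      · have ha : encode a = c := mem_decode₂.1 hd
        rw [Option.map_some, ← ih]
        constructor
        · rintro ⟨_ | ⟨a', w⟩, hw, h⟩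
          · simp at h
          · rw [List.map_cons, List.cons.injEq, ← ha] at h
            obtain ⟨h1, h2⟩ := h
            rw [encode_injective h1] at hw
            exact ⟨w, hw, h2⟩
        · rintro ⟨w, hw, rfl⟩
          exact ⟨a :: w, hw, by rw [List.map_cons, ha]⟩
  have hfold : Primrec fun l : List ℕ => l.foldl step (some M.start) :=
    Primrec.list_foldl Primrec.id (Primrec.const _)
      (hstep.comp (Primrec.fst.comp Primrec.snd) (Primrec.snd.comp Primrec.snd)).to₂
  have hacc : PrimrecPred fun s : Option σ => ∃ q ∈ M.accept, s = some q :=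
    ⟨inferInstance, Primrec.dom_finite _⟩
  exact (hacc.comp hfold).of_eq fun l => (hrun l M.start).symm

/-! ### Primitive recursive bounds for codes -/

/-- A bound for the codes of the lists of length at most `k` with entries at most `b`. -/
def listBound (b : ℕ) : ℕ → ℕ
  | 0 => 0
  | k + 1 => (Nat.pair b (listBound b k)).succ

theorem pair_le_pair {a a' b b' : ℕ} (ha : a ≤ a') (hb : b ≤ b') : Nat.pair a b ≤ Nat.pair a' b' := by
  calc Nat.pair a b ≤ Nat.pair a' b := by
        rcases ha.lt_or_eq with h | rfl
        · exact (Nat.pair_lt_pair_left b h).le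
        · rfl
    _ ≤ Nat.pair a' b' := by
        rcases hb.lt_or_eq with h | rfl
        · exact (Nat.pair_lt_pair_right a' h).le
        · rfl

theorem encode_le_listBound {α : Type*} [Encodable α] {b : ℕ} :
    ∀ {k : ℕ} {l : List α}, l.length ≤ k → (∀ a ∈ l, encode a ≤ b) → encode l ≤ listBound b k := by
  intro k
  induction k with
  | zero =>
    intro l hl _
    rw [List.eq_nil_of_length_eq_zero (Nat.le_zero.1 hl)]
    rfl
  | succ k ih =>
    intro l hl hb
    obtain _ | ⟨a, l⟩ := l
    · exact Nat.zero_le _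
    · rw [encode_list_cons, listBound]
      refine Nat.succ_le_succ (pair_le_pair (hb a (by simp)) (ih (by simpa using hl) fun c hc => ?_))
      exact hb c (by simp [hc])

theorem primrec₂_listBound : Primrec₂ listBound := by
  have h : Primrec₂ fun b k : ℕ => Nat.rec (motive := fun _ => ℕ) 0
      (fun _ r => (Nat.pair b r).succ) k :=
    Primrec.nat_rec (Primrec.const 0)
      (Primrec.succ.comp (Primrec₂.natPair.comp Primrec.fst
        (Primrec.snd.comp Primrec.snd))).to₂
  refine h.of_eq fun b k => ?_
  induction k with
  | zero => rfl
  | succ k ih => simp only [listBound, ← ih]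

theorem primrec₂_nat_pow : Primrec₂ ((· ^ ·) : ℕ → ℕ → ℕ) :=
  Primrec₂.unpaired'.1 Nat.Primrec.pow

theorem primrec₂_modelBound (K p s : ℕ) : Primrec₂ (modelBound K p s) := by
  have add : ∀ {f g : ℕ × ℕ → ℕ}, Primrec f → Primrec g → Primrec fun a => f a + g a :=
    fun hf hg => Primrec.nat_add.comp hf hg
  have mul : ∀ {f g : ℕ × ℕ → ℕ}, Primrec f → Primrec g → Primrec fun a => f a * g a :=
    fun hf hg => Primrec.nat_mul.comp hf hg
  have c : ∀ k : ℕ, Primrec fun _ : ℕ × ℕ => k := Primrec.const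
  have hF : Primrec fun a : ℕ × ℕ => a.2 * (K + 1) ^ a.1 :=
    mul .snd (primrec₂_nat_pow.comp (c _) .fst)
  have hN : Primrec fun a : ℕ × ℕ => (K + 1) * (a.2 * (K + 1) ^ a.1) + 1 :=
    add (mul (c _) hF) (c _)
  have hnp : Primrec fun a : ℕ × ℕ => a.1 * p := mul .fst (c _)
  refine add hF (add (add (c s) hnp) (mul .fst (mul (add (add hnp (c 1)) hN) (mul (c 2)
    (mul (add (mul (c 2) hnp) (c 1)) (c p))))))

/-! ### Recursion over the codes of quantifier-free formulas -/

/-- The evaluation of the code of a quantifier-free formula, where `atom` evaluates atomic formulas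
and `op` evaluates implications. -/
def codeFold (atom : ℕ → Bool) (op : Bool → Bool → Bool) (m : ℕ) : Bool :=
  if _ : m % 4 = 3 then
    op (codeFold atom op (m / 4).unpair.1) (codeFold atom op (m / 4).unpair.2)
  else atom m
termination_by m
decreasing_by
  · have := Nat.unpair_left_le (m / 4); omega
  · have := Nat.unpair_right_le (m / 4); omega

theorem codeFold_of_ne {atom : ℕ → Bool} {op : Bool → Bool → Bool} {m : ℕ} (h : m % 4 ≠ 3) :
    codeFold atom op m = atom m := by
  rw [codeFold, dif_neg h]

theorem codeFold_imp {atom : ℕ → Bool} {op : Bool → Bool → Bool} {a b : ℕ} :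
    codeFold atom op (4 * Nat.pair a b + 3) = op (codeFold atom op a) (codeFold atom op b) := by
  rw [codeFold, dif_pos (by omega), show (4 * Nat.pair a b + 3) / 4 = Nat.pair a b by omega,
    Nat.unpair_pair]

theorem primrec₂_codeFold {α : Type*} [Primcodable α] {atom : α → ℕ → Bool} (h : Primrec₂ atom)
    (op : Bool → Bool → Bool) : Primrec₂ fun a m => codeFold (atom a) op m := by
  have hlen : Primrec fun p : α × List Bool => p.2.length := Primrec.list_length.comp Primrec.snd
  have hun : Primrec fun p : α × List Bool => (p.2.length / 4).unpair :=
    Primrec.unpair.comp (Primrec.nat_div.comp hlen (Primrec.const 4))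
  -- Course-of-values recursion: `l` lists the values at all smaller numbers. The default `false` is
  -- never reached, because both components lie below the current code.
  refine Primrec.nat_strong_rec _ (g := fun a l => some
    (if l.length % 4 = 3 then op (l.getD (l.length / 4).unpair.1 false)
      (l.getD (l.length / 4).unpair.2 false) else atom a l.length)) ?_ ?_
  · refine Primrec.option_some.comp (Primrec.ite ?_ ?_ (h.comp Primrec.fst hlen))
    · exact Primrec.eq.comp (Primrec.nat_mod.comp hlen (Primrec.const 4)) (Primrec.const 3)
    · exact (Primrec.dom_bool₂ op).comp
        ((Primrec.list_getD false).comp Primrec.snd (Primrec.fst.comp hun))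
        ((Primrec.list_getD false).comp Primrec.snd (Primrec.snd.comp hun))
  · intro a n
    simp only [List.length_map, List.length_range]
    by_cases hn : n % 4 = 3
    · have h1 : (n / 4).unpair.1 < n := by have := Nat.unpair_left_le (n / 4); omega
      have h2 : (n / 4).unpair.2 < n := by have := Nat.unpair_right_le (n / 4); omega
      rw [if_pos hn, codeFold, dif_pos hn]
      simp [List.getD_eq_getElem?_getD, h1, h2]
    · rw [if_neg hn, codeFold_of_ne hn]

/-- The value of a term, given by its code, under an assignment of (codes of) words. -/
def termValue (l : List ℕ) (t : ℕ) : ℕ :=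
  if t % 2 = 0 then l.getD (t / 2) 0 else t / 2

theorem primrec₂_termValue : Primrec₂ termValue :=
  Primrec.ite (Primrec.eq.comp (Primrec.nat_mod.comp Primrec.snd (Primrec.const 2))
      (Primrec.const 0))
    ((Primrec.list_getD 0).comp Primrec.fst (Primrec.nat_div.comp Primrec.snd (Primrec.const 2)))
    (Primrec.nat_div.comp Primrec.snd (Primrec.const 2))

/-- The truth value of an atomic formula, given by its code. -/
def atomValue (l : List ℕ) (m : ℕ) : Bool :=
  decide (m % 4 = 1 ∧ termValue l (m / 4).unpair.1 = termValue l (m / 4).unpair.2 ∨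
    m % 4 = 2 ∧ (Denumerable.ofNat (List ℕ) (termValue l (m / 4).unpair.1)).Sublist
      (Denumerable.ofNat (List ℕ) (termValue l (m / 4).unpair.2)))

theorem primrec_unpair_snd_div {α : Type*} [Primcodable α] :
    Primrec fun p : α × ℕ => (p.2 / 4).unpair :=
  Primrec.unpair.comp (Primrec.nat_div.comp Primrec.snd (Primrec.const 4))

theorem primrecPred_snd_mod {α : Type*} [Primcodable α] (k : ℕ) :
    PrimrecPred fun p : α × ℕ => p.2 % 4 = k :=
  Primrec.eq.comp (Primrec.nat_mod.comp Primrec.snd (Primrec.const 4)) (Primrec.const k)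

theorem primrec₂_atomValue : Primrec₂ atomValue := by
  have h1 : Primrec fun p : List ℕ × ℕ => termValue p.1 (p.2 / 4).unpair.1 :=
    primrec₂_termValue.comp Primrec.fst (Primrec.fst.comp primrec_unpair_snd_div)
  have h2 : Primrec fun p : List ℕ × ℕ => termValue p.1 (p.2 / 4).unpair.2 :=
    primrec₂_termValue.comp Primrec.fst (Primrec.snd.comp primrec_unpair_snd_div)
  exact (((primrecPred_snd_mod 1).and (Primrec.eq.comp h1 h2)).or
    ((primrecPred_snd_mod 2).and (primrecRel_sublist.comp ((Primrec.ofNat (List ℕ)).comp h1)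
      ((Primrec.ofNat (List ℕ)).comp h2)))).decide

/-- Whether a number is the code of a variable below `n` or of a constant whose code satisfies
`d`. -/
def isTermCode (d : ℕ → Bool) (n t : ℕ) : Bool :=
  decide (t % 2 = 0 ∧ t / 2 < n ∨ t % 2 = 1 ∧ d (t / 2) = true)

/-- Whether a number is the code of an atomic formula or of falsum. -/
def isAtomCode (d : ℕ → Bool) (n m : ℕ) : Bool :=
  decide (m = 0 ∨ (m % 4 = 1 ∨ m % 4 = 2) ∧ isTermCode d n (m / 4).unpair.1 = true ∧
    isTermCode d n (m / 4).unpair.2 = true)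

theorem primrec₂_isTermCode {d : ℕ → Bool} (hd : Primrec d) : Primrec₂ (isTermCode d) := by
  have h2 : Primrec fun p : ℕ × ℕ => p.2 / 2 := Primrec.nat_div.comp Primrec.snd (Primrec.const 2)
  have hm : ∀ k, PrimrecPred fun p : ℕ × ℕ => p.2 % 2 = k := fun k =>
    Primrec.eq.comp (Primrec.nat_mod.comp Primrec.snd (Primrec.const 2)) (Primrec.const k)
  exact (((hm 0).and (Primrec.nat_lt.comp h2 Primrec.fst)).or
    ((hm 1).and (Primrec.eq.comp (hd.comp h2) (Primrec.const true)))).decide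

theorem primrec₂_isAtomCode {d : ℕ → Bool} (hd : Primrec d) : Primrec₂ (isAtomCode d) := by
  have h := primrec₂_isTermCode hd
  have h1 : Primrec fun p : ℕ × ℕ => isTermCode d p.1 (p.2 / 4).unpair.1 :=
    h.comp Primrec.fst (Primrec.fst.comp primrec_unpair_snd_div)
  have h2 : Primrec fun p : ℕ × ℕ => isTermCode d p.1 (p.2 / 4).unpair.2 :=
    h.comp Primrec.fst (Primrec.snd.comp primrec_unpair_snd_div)
  exact ((Primrec.eq.comp Primrec.snd (Primrec.const 0)).or
    (((primrecPred_snd_mod 1).or (primrecPred_snd_mod 2)).and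
      ((Primrec.eq.comp h1 (Primrec.const true)).and
        (Primrec.eq.comp h2 (Primrec.const true))))).decide

/-- The code of `∃ x, φ` as a function of the code of `φ`. -/
def exCode (m : ℕ) : ℕ :=
  -- `∃` abbreviates `¬∀¬`, and `¬φ` is `φ → ⊥`, where `⊥` has code `0`.
  4 * Nat.pair (4 * (4 * Nat.pair m 0 + 3) + 4) 0 + 3

theorem lt_exCode (m : ℕ) : m < exCode m := by
  have h1 := Nat.left_le_pair m 0
  have h2 := Nat.left_le_pair (4 * (4 * Nat.pair m 0 + 3) + 4) 0
  unfold exCode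
  omega

/-- Bounds both the number of quantifiers and the code of the matrix by the code of the sentence,
which makes the search for them finite. -/
theorem add_le_exCode_iterate (n m : ℕ) : m + n ≤ exCode^[n] m := by
  induction n with
  | zero => simp
  | succ n ih =>
    rw [Function.iterate_succ_apply']
    have := lt_exCode (exCode^[n] m)
    omega

theorem primrec_exCode : Primrec exCode := by
  have mul : ∀ {f : ℕ → ℕ}, Primrec f → Primrec fun a => 4 * f a :=
    fun hf => Primrec.nat_mul.comp (Primrec.const 4) hf
  have add : ∀ {f : ℕ → ℕ} (k : ℕ), Primrec f → Primrec fun a => f a + k :=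
    fun k hf => Primrec.nat_add.comp hf (Primrec.const k)
  have pr : ∀ {f : ℕ → ℕ}, Primrec f → Primrec fun a => Nat.pair (f a) 0 :=
    fun hf => Primrec₂.natPair.comp hf (Primrec.const 0)
  exact add 3 (mul (pr (add 4 (mul (add 3 (mul (pr Primrec.id)))))))

/-- `m` is the code of a sentence with `n` existential quantifiers and a quantifier-free matrix with
code `X` that is satisfied by the list of codes coded by `s`. -/
def IsWitness (d : ℕ → Bool) (n m X s : ℕ) : Prop :=
  exCode^[n] X = m ∧ codeFold (isAtomCode d n) (fun a b => a && b) X = true ∧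
    (Denumerable.ofNat (List ℕ) s).length = n ∧
    (∀ c ∈ Denumerable.ofNat (List ℕ) s, d c = true) ∧
    codeFold (atomValue (Denumerable.ofNat (List ℕ) s)) (fun a b => !a || b) X = true

/-- `m` is the code of an existential sentence that has a witness with a code below `bound n m`,
where `n` is the number of quantifiers. -/
def HasBoundedWitness (d : ℕ → Bool) (bound : ℕ → ℕ → ℕ) (m : ℕ) : Prop :=
  ∃ n < m + 1, ∃ X < m + 1, ∃ s < bound n m, IsWitness d n m X s

theorem primrecRel_exists_lt {β : Type*} [Primcodable β] {R : ℕ → β → Prop} (hR : PrimrecRel R) :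
    PrimrecRel fun (k : ℕ) (y : β) => ∃ x < k, R x y :=
  (hR.exists_mem_list.comp (Primrec.list_range.comp Primrec.fst) Primrec.snd).of_eq
    fun p => by simp

theorem primrecPred_hasBoundedWitness {d : ℕ → Bool} (hd : Primrec d) {bound : ℕ → ℕ → ℕ}
    (hb : Primrec₂ bound) : PrimrecPred (HasBoundedWitness d bound) := by
  have hs : Primrec fun p : ℕ × ℕ × ℕ × ℕ => Denumerable.ofNat (List ℕ) p.1 :=
    (Primrec.ofNat (List ℕ)).comp Primrec.fst
  have hX : Primrec fun p : ℕ × ℕ × ℕ × ℕ => p.2.1 := Primrec.fst.comp Primrec.snd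
  have hn : Primrec fun p : ℕ × ℕ × ℕ × ℕ => p.2.2.1 :=
    Primrec.fst.comp (Primrec.snd.comp Primrec.snd)
  have hm : Primrec fun p : ℕ × ℕ × ℕ × ℕ => p.2.2.2 :=
    Primrec.snd.comp (Primrec.snd.comp Primrec.snd)
  have hall : PrimrecPred fun l : List ℕ => ∀ c ∈ l, d c = true :=
    (Primrec.eq.comp hd (Primrec.const true)).forall_mem_list
  have h0 : PrimrecRel fun (s : ℕ) (y : ℕ × ℕ × ℕ) => IsWitness d y.2.1 y.2.2 y.1 s := by
    refine PrimrecPred.and ?_ (PrimrecPred.and ?_ (PrimrecPred.and ?_ (PrimrecPred.and ?_ ?_)))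
    · exact Primrec.eq.comp
        (Primrec.nat_iterate hn hX (primrec_exCode.comp Primrec.snd).to₂) hm
    · exact Primrec.eq.comp ((primrec₂_codeFold (primrec₂_isAtomCode hd) _).comp hn hX)
        (Primrec.const true)
    · exact Primrec.eq.comp (Primrec.list_length.comp hs) hn
    · exact hall.comp hs
    · exact Primrec.eq.comp ((primrec₂_codeFold primrec₂_atomValue _).comp hs hX)
        (Primrec.const true)
  have e0 : PrimrecRel fun (k : ℕ) (y : ℕ × ℕ × ℕ) => ∃ s < k, IsWitness d y.2.1 y.2.2 y.1 s :=
    primrecRel_exists_lt h0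
  have h1 : PrimrecPred fun y : ℕ × ℕ × ℕ =>
      ∃ s < bound y.2.1 y.2.2, IsWitness d y.2.1 y.2.2 y.1 s :=
    e0.comp (hb.comp (Primrec.fst.comp Primrec.snd) (Primrec.snd.comp Primrec.snd)) Primrec.id
  have e1 : PrimrecRel fun (k : ℕ) (y : ℕ × ℕ) =>
      ∃ X < k, ∃ s < bound y.1 y.2, IsWitness d y.1 y.2 X s :=
    primrecRel_exists_lt (R := fun X (y : ℕ × ℕ) => ∃ s < bound y.1 y.2, IsWitness d y.1 y.2 X s) h1
  have h2 : PrimrecPred fun y : ℕ × ℕ =>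
      ∃ X < y.2 + 1, ∃ s < bound y.1 y.2, IsWitness d y.1 y.2 X s :=
    e1.comp (Primrec.succ.comp Primrec.snd) Primrec.id
  have e2 : PrimrecRel fun k m : ℕ =>
      ∃ n < k, ∃ X < m + 1, ∃ s < bound n m, IsWitness d n m X s :=
    primrecRel_exists_lt
      (R := fun n m : ℕ => ∃ X < m + 1, ∃ s < bound n m, IsWitness d n m X s) h2
  exact e2.comp Primrec.succ Primrec.id

end Codes

/-! ### Existential sentences and their codes -/

section Sentences

open Encodable FirstOrder FirstOrder.Language FirstOrder.Language.BoundedFormula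

variable {A : Type*} {L : Language A}

theorem exs_isExistential {S : FirstOrder.Language} :
    ∀ {n : ℕ} {φ : S.BoundedFormula Empty n}, φ.IsExistential → IsExistential φ.exs
  | 0, _, h => h
  | _ + 1, _, h => by
    have := exs_isExistential h.ex
    exact this

/-- Stated with `k` free variables for the induction; for a sentence, `φ.exs` is `φ` itself. -/
theorem exists_isQF_of_isExistential {S : FirstOrder.Language} {k : ℕ}
    {φ : S.BoundedFormula Empty k} (h : φ.IsExistential) :
    ∃ (n : ℕ) (ψ : S.BoundedFormula Empty n), ψ.IsQF ∧ φ.exs = ψ.exs := by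
  induction h with
  | of_isQF h => exact ⟨_, _, h, rfl⟩
  | ex _ ih => exact ih

theorem formulaCode_exs [Encodable A] :
    ∀ {n : ℕ} (φ : (subwordSignature L).BoundedFormula Empty n),
      formulaCode φ.exs = exCode^[n] (formulaCode φ)
  | 0, _ => rfl
  | n + 1, φ => by
    rw [BoundedFormula.exs, formulaCode_exs φ.ex, Function.iterate_succ_apply]
    rfl

theorem equal_code [Encodable A] {n : ℕ} (t₁ t₂ : (subwordSignature L).Term (Empty ⊕ Fin n)) :
    formulaCode (t₁.bdEqual t₂) = 4 * Nat.pair (termCode t₁) (termCode t₂) + 1 := rfl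

/-! #### Evaluation -/

section Evaluation

variable [Encodable A]

/-- The codes of the values of the variables. -/
def assignmentCode {n : ℕ} (xs : Fin n → {w : List A // w ∈ L}) : List ℕ :=
  List.ofFn fun i => encode (xs i).1

theorem termValue_termCode {n : ℕ} (t : (subwordSignature L).Term (Empty ⊕ Fin n))
    (xs : Fin n → {w : List A // w ∈ L}) :
    termValue (assignmentCode xs) (termCode t) =
      encode (t.realize (Sum.elim (default : Empty → {w : List A // w ∈ L}) xs)).1 := by
  rcases t with (e | i) | ⟨⟨w⟩, ss⟩
  · exact e.elim
  · simp [termValue, termCode, assignmentCode, List.getD_eq_getElem?_getD]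
  · have h : (2 * encode w.1 + 1) % 2 ≠ 0 := by omega
    rw [termCode, termValue, if_neg h, show (2 * encode w.1 + 1) / 2 = encode w.1 by omega]
    rfl

theorem codeFold_formulaCode {n : ℕ} {φ : (subwordSignature L).BoundedFormula Empty n}
    (hφ : φ.IsQF) (xs : Fin n → {w : List A // w ∈ L}) :
    codeFold (atomValue (assignmentCode xs)) (fun a b => !a || b) (formulaCode φ) = true ↔
      φ.Realize default xs := by
  induction hφ with
  | falsum =>
    rw [formulaCode, codeFold_of_ne (by omega)]
    simp [atomValue, BoundedFormula.Realize]
  | of_isAtomic h =>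
    cases h with
    | equal t₁ t₂ =>
      rw [realize_bdEqual, equal_code, codeFold_of_ne (by omega), atomValue, decide_eq_true_iff,
        show (4 * Nat.pair (termCode t₁) (termCode t₂) + 1) / 4 =
          Nat.pair (termCode t₁) (termCode t₂) by omega, Nat.unpair_pair, termValue_termCode,
        termValue_termCode, encode_inj, Subtype.ext_iff]
      have h1 : (4 * Nat.pair (termCode t₁) (termCode t₂) + 1) % 4 = 1 := by omega
      simp [h1]
    | rel R ts =>
      cases R
      have h1 : (4 * Nat.pair (termCode (ts 0)) (termCode (ts 1)) + 2) % 4 = 2 := by omega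
      have hc : formulaCode (Relations.boundedFormula (L := subwordSignature L)
          SubwordRelation.sub ts) = 4 * Nat.pair (termCode (ts 0)) (termCode (ts 1)) + 2 := rfl
      rw [hc, codeFold_of_ne (by omega), atomValue, decide_eq_true_iff,
        show (4 * Nat.pair (termCode (ts 0)) (termCode (ts 1)) + 2) / 4 =
          Nat.pair (termCode (ts 0)) (termCode (ts 1)) by omega, Nat.unpair_pair,
        termValue_termCode, termValue_termCode, ofNat_encode_list, ofNat_encode_list,
        map_encode_sublist, h1]
      simp only [OfNat.ofNat_ne_one, false_and, true_and, false_or]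
      exact Iff.rfl
  | imp _ _ ih₁ ih₂ =>
    rw [formulaCode, codeFold_imp, realize_imp, ← ih₁, ← ih₂, Bool.or_eq_true,
      Bool.not_eq_true', ← Bool.not_eq_true, imp_iff_not_or]

end Evaluation

/-! #### Recognition of codes -/

section Recognition

variable [Encodable A] {d : ℕ → Bool}

theorem isTermCode_iff (hd : ∀ c, d c = true ↔ ∃ w ∈ L, encode w = c) {n t : ℕ} :
    isTermCode d n t = true ↔
      ∃ s : (subwordSignature L).Term (Empty ⊕ Fin n), termCode s = t := by
  rw [isTermCode, decide_eq_true_iff, hd]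
  constructor
  · rintro (⟨h1, h2⟩ | ⟨h1, w, hw, h2⟩)
    · exact ⟨.var (Sum.inr ⟨t / 2, h2⟩), by simp only [termCode]; omega⟩
    · exact ⟨.func (SubwordFunction.const ⟨w, hw⟩) Fin.elim0, by simp only [termCode]; omega⟩
  · rintro ⟨(e | i) | ⟨⟨w⟩, ss⟩, rfl⟩
    · exact e.elim
    · left
      simp only [termCode]
      have := i.2
      omega
    · right
      simp only [termCode]
      exact ⟨by omega, w.1, w.2, by omega⟩

/-- Residue `3` modulo `4` marks implications, which the fold takes apart. Among the other codes,
the positive multiples of `4` belong to universal quantifiers, and `isAtomCode` rejects them. -/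
theorem codeFold_isAtomCode_iff (hd : ∀ c, d c = true ↔ ∃ w ∈ L, encode w = c) {n m : ℕ} :
    codeFold (isAtomCode d n) (fun a b => a && b) m = true ↔
      ∃ φ : (subwordSignature L).BoundedFormula Empty n, φ.IsQF ∧ formulaCode φ = m := by
  constructor
  · induction m using Nat.strong_induction_on with
    | _ m ih =>
      intro h
      by_cases hm : m % 4 = 3
      · obtain ⟨a, b, rfl⟩ : ∃ a b, m = 4 * Nat.pair a b + 3 :=
          ⟨(m / 4).unpair.1, (m / 4).unpair.2, by rw [Nat.pair_unpair]; omega⟩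
        rw [codeFold_imp, Bool.and_eq_true] at h
        have h1 := Nat.left_le_pair a b
        have h2 := Nat.right_le_pair a b
        obtain ⟨φ, hφ, rfl⟩ := ih a (by omega) h.1
        obtain ⟨ψ, hψ, rfl⟩ := ih b (by omega) h.2
        exact ⟨φ.imp ψ, hφ.imp hψ, rfl⟩
      · rw [codeFold_of_ne hm, isAtomCode, decide_eq_true_iff, isTermCode_iff hd,
          isTermCode_iff hd] at h
        rcases h with rfl | ⟨h, ⟨t₁, h₁⟩, t₂, h₂⟩
        · exact ⟨falsum, .falsum, rfl⟩
        have hp : Nat.pair (termCode t₁) (termCode t₂) = m / 4 := by rw [h₁, h₂, Nat.pair_unpair]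
        rcases h with h | h
        · exact ⟨t₁.bdEqual t₂, .of_isAtomic (.equal _ _), by rw [equal_code]; omega⟩
        · refine ⟨Relations.boundedFormula (L := subwordSignature L) SubwordRelation.sub ![t₁, t₂],
            .of_isAtomic (.rel _ _), ?_⟩
          change 4 * Nat.pair (termCode t₁) (termCode t₂) + 2 = m
          omega
  · rintro ⟨φ, hφ, rfl⟩
    induction hφ with
    | falsum => rw [formulaCode, codeFold_of_ne (by omega)]; simp [isAtomCode]
    | of_isAtomic h =>
      have key : ∀ (t₁ t₂ : (subwordSignature L).Term (Empty ⊕ Fin n)) (k : ℕ), k = 1 ∨ k = 2 →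
          codeFold (isAtomCode d n) (fun a b => a && b)
            (4 * Nat.pair (termCode t₁) (termCode t₂) + k) = true := by
        intro t₁ t₂ k hk
        rw [codeFold_of_ne (by omega), isAtomCode, decide_eq_true_iff,
          show (4 * Nat.pair (termCode t₁) (termCode t₂) + k) / 4 =
            Nat.pair (termCode t₁) (termCode t₂) by omega, Nat.unpair_pair, isTermCode_iff hd,
          isTermCode_iff hd]
        exact Or.inr ⟨by omega, ⟨t₁, rfl⟩, t₂, rfl⟩
      cases h with
      | equal t₁ t₂ => exact key t₁ t₂ 1 (Or.inl rfl)
      | rel R ts => cases R; exact key (ts 0) (ts 1) 2 (Or.inr rfl)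
    | imp _ _ ih₁ ih₂ => rw [formulaCode, codeFold_imp, ih₁, ih₂]; rfl

end Recognition

/-! #### Invariance under words of the same type -/

section Invariance

variable [Encodable A]

/-- The code of a word is at least its length, so constants with term code at most `N` are among the
parameters controlled by `SameType N`. -/
theorem sublist_realize_iff {n N : ℕ} {xs xs' : Fin n → {w : List A // w ∈ L}}
    (h : SameType N (fun i => (xs i).1) (fun i => (xs' i).1))
    (t₁ t₂ : (subwordSignature L).Term (Empty ⊕ Fin n)) (h₁ : termCode t₁ ≤ N)
    (h₂ : termCode t₂ ≤ N) :
    ((t₁.realize (Sum.elim (default : Empty → {w : List A // w ∈ L}) xs)).1.Sublist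
      (t₂.realize (Sum.elim (default : Empty → {w : List A // w ∈ L}) xs)).1) ↔
    ((t₁.realize (Sum.elim (default : Empty → {w : List A // w ∈ L}) xs')).1.Sublist
      (t₂.realize (Sum.elim (default : Empty → {w : List A // w ∈ L}) xs')).1) := by
  have hlen : ∀ w : {w : List A // w ∈ L}, 2 * encode w.1 + 1 ≤ N → w.1.length ≤ N := by
    intro w hw
    have := length_le_encode w.1
    omega
  rcases t₁ with (e | i) | ⟨⟨w⟩, ss⟩
  · exact e.elim
  · rcases t₂ with (e | j) | ⟨⟨v⟩, ts⟩
    · exact e.elim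
    · exact h.1 i j
    · exact (h.2 i v.1 (hlen v h₂)).1
  · rcases t₂ with (e | j) | ⟨⟨v⟩, ts⟩
    · exact e.elim
    · exact (h.2 j w.1 (hlen w h₁)).2
    · exact Iff.rfl

theorem realize_iff_of_sameType {n N : ℕ} {xs xs' : Fin n → {w : List A // w ∈ L}}
    (h : SameType N (fun i => (xs i).1) (fun i => (xs' i).1))
    {φ : (subwordSignature L).BoundedFormula Empty n} (hφ : φ.IsQF) (hN : formulaCode φ ≤ N) :
    φ.Realize default xs ↔ φ.Realize default xs' := by
  induction hφ with
  | falsum => rfl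
  | of_isAtomic h' =>
    cases h' with
    | equal t₁ t₂ =>
      rw [equal_code] at hN
      have h1 := Nat.left_le_pair (termCode t₁) (termCode t₂)
      have h2 := Nat.right_le_pair (termCode t₁) (termCode t₂)
      have h12 := sublist_realize_iff h t₁ t₂ (by omega) (by omega)
      have h21 := sublist_realize_iff h t₂ t₁ (by omega) (by omega)
      -- `SameType` does not mention equality; antisymmetry of the subword order reduces it to two
      -- subword relations.
      have anti : ∀ u v : {w : List A // w ∈ L}, u = v ↔ u.1.Sublist v.1 ∧ v.1.Sublist u.1 :=
        fun u v => ⟨fun h => by simp [h], fun h => Subtype.ext (h.1.antisymm h.2)⟩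
      rw [realize_bdEqual, realize_bdEqual, anti, anti, h12, h21]
    | rel R ts =>
      cases R
      have hc : 4 * Nat.pair (termCode (ts 0)) (termCode (ts 1)) + 2 ≤ N := hN
      have h1 := Nat.left_le_pair (termCode (ts 0)) (termCode (ts 1))
      have h2 := Nat.right_le_pair (termCode (ts 0)) (termCode (ts 1))
      exact sublist_realize_iff h (ts 0) (ts 1) (by omega) (by omega)
  | @imp φ ψ _ _ ih₁ ih₂ =>
    rw [formulaCode] at hN
    have h1 := Nat.left_le_pair (formulaCode φ) (formulaCode ψ)
    have h2 := Nat.right_le_pair (formulaCode φ) (formulaCode ψ)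
    rw [realize_imp, realize_imp, ih₁ (by omega), ih₂ (by omega)]

end Invariance

end Sentences

/-! ### The decision procedure -/

open Encodable FirstOrder.Language in
-- The code `m` of the sentence exceeds the length of each of its constants, so it serves as the
-- parameter bound `N` of the small model. The inner `listBound` bounds the code of one witness, the
-- outer one that of the list of all `n`; the final `+ 1` makes the bound strict.
theorem mem_sigmaOneTheory_code_iff {A : Type*} [Encodable A] {L : Language A} {d : ℕ → Bool}
    (hd : ∀ c, d c = true ↔ ∃ w ∈ L, encode w = c) {b K p s : ℕ} (hb : ∀ a : A, encode a ≤ b)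
    (hmodel : ∀ n N (x : Fin n → List A), (∀ i, x i ∈ L) → ∃ x' : Fin n → List A,
      (∀ i, x' i ∈ L ∧ (x' i).length ≤ modelBound K p s n N) ∧ SameType N x x') (m : ℕ) :
    (∃ φ ∈ sigmaOneTheory (subwordSignature L) {w : List A // w ∈ L}, formulaCode φ = m) ↔
      HasBoundedWitness d
        (fun n m => listBound (listBound b (modelBound K p s n m)) n + 1) m := by
  constructor
  · rintro ⟨φ, ⟨hφ, hreal⟩, rfl⟩
    obtain ⟨n, ψ, hψ, h : φ = ψ.exs⟩ := exists_isQF_of_isExistential hφ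
    subst h
    obtain ⟨xs, hxs⟩ := BoundedFormula.realize_exs.1 hreal
    have hcode := formulaCode_exs ψ
    have hle := add_le_exCode_iterate n (formulaCode ψ)
    rw [← hcode] at hle
    -- The code of the whole sentence is used instead of that of the matrix, since the search bound
    -- may depend only on `n` and `m`.
    obtain ⟨x', hx', htype⟩ := hmodel n (formulaCode ψ.exs) (fun i => (xs i).1) fun i => (xs i).2
    let xs' : Fin n → {w : List A // w ∈ L} := fun i => ⟨x' i, (hx' i).1⟩
    have hreal' : ψ.Realize default xs' :=
      (realize_iff_of_sameType (xs' := xs') htype hψ (by omega)).1 hxs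
    refine ⟨n, by omega, formulaCode ψ, by omega, encode (assignmentCode xs'), ?_, hcode.symm,
      (codeFold_isAtomCode_iff hd).2 ⟨ψ, hψ, rfl⟩, ?_⟩
    · refine Nat.lt_succ_of_le (encode_le_listBound (by simp [assignmentCode]) ?_)
      intro c hc
      obtain ⟨i, rfl⟩ := (List.mem_ofFn' _ _).1 hc
      exact encode_le_listBound (hx' i).2 fun a _ => hb a
    · rw [Denumerable.ofNat_encode]
      refine ⟨by simp [assignmentCode], ?_, (codeFold_formulaCode hψ xs').2 hreal'⟩
      intro c hc
      obtain ⟨i, rfl⟩ := (List.mem_ofFn' _ _).1 hc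
      exact (hd _).2 ⟨x' i, (hx' i).1, rfl⟩
  · rintro ⟨n, -, X, -, s, -, rfl, hX, hlen, hmem, hval⟩
    obtain ⟨ψ, hψ, rfl⟩ := (codeFold_isAtomCode_iff hd).1 hX
    have hw : ∀ i : Fin n, ∃ w ∈ L,
        encode w = (Denumerable.ofNat (List ℕ) s)[(i : ℕ)]'(by rw [hlen]; exact i.2) :=
      fun i => (hd _).1 (hmem _ (List.getElem_mem _))
    choose x hx hxs using hw
    have hs : assignmentCode (fun i => (⟨x i, hx i⟩ : {w : List A // w ∈ L})) =
        Denumerable.ofNat (List ℕ) s := by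
      refine List.ext_getElem (by simp [assignmentCode, hlen]) fun i h1 h2 => ?_
      simp [assignmentCode, hxs]
    rw [← hs, codeFold_formulaCode hψ] at hval
    exact ⟨ψ.exs, ⟨exs_isExistential hψ.isExistential, BoundedFormula.realize_exs.2 ⟨_, hval⟩⟩,
      formulaCode_exs ψ⟩

theorem theorem6p2 {A : Type*} [Finite A] [DecidableEq A] [Encodable A] (L : Language A)
    (hreg : L.IsRegular) (hunb : ¬ IsBoundedLanguage L) (hfreq : HasNonNegligibleLetters L) :
    IsDecidableTheory (sigmaOneTheory (subwordSignature L) {w : List A // w ∈ L}) := by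
  classical
  obtain ⟨K, p, s, hmodel⟩ := exists_short_sameType hreg hunb hfreq
  obtain ⟨b, hb⟩ := (Set.finite_range (Encodable.encode : A → ℕ)).bddAbove
  have hmem : PrimrecPred fun c : ℕ => ∃ w ∈ L, Encodable.encode w = c :=
    ((primrecPred_mem_of_isRegular hreg).comp (Primrec.ofNat (List ℕ))).of_eq fun c => by
      refine exists_congr fun w => and_congr_right fun _ => ?_
      exact ⟨fun h => by rw [← encode_map_encode, h, Denumerable.encode_ofNat],
        fun h => by rw [← h, ofNat_encode_list]⟩
  have hbound : Primrec₂ fun n m =>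
      listBound (listBound b (modelBound K p s n m)) n + 1 :=
    Primrec.succ.comp (primrec₂_listBound.comp (primrec₂_listBound.comp (Primrec.const b)
      (primrec₂_modelBound K p s)) Primrec.fst)
  refine ((primrecPred_hasBoundedWitness hmem.decide hbound).of_eq fun m => ?_).computablePred
  exact (mem_sigmaOneTheory_code_iff (fun c => decide_eq_true_iff) (fun a => hb ⟨a, rfl⟩)
    hmodel m).symm
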